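/- Write $I=\{0<1\}$ and let $V\subset I\times I$ be the sub-poset $\{(1,0),(0,0),(0,1)\}$. Let $(\mathcal M,\wedge)$ be a (not necessarily symmetric) monoidal model category that has a zero object $\star$ (for instance, any stable monoidal model category). Here a monoidal model category is a model category with functorial factorizations and a closed monoidal structure (tensoring with any object, on either side, is a left adjoint) that satisfies the pushout-product axiom and the unit axiom (some cofibrant replacement $QS\to S$ of the unit stays a weak equivalence after smashing, on either side, with any cofibrant object). For a finite poset $C$ let $\mathrm{Ho}(\mathcal M^C)$ be the localization of the category $\mathcal M^C$ of $C$-shaped diagrams at the vertex-wise weak equivalences. The functor $V_\star:\mathcal M^I\to\mathcal M^V$, sending $f:X\to Y$ to the diagram $\star\leftarrow X\xrightarrow{f}Y$ with $f$ at the edge $(0,0)<(0,1)$ and $\star$ at $(1,0)$, preserves weak equivalences and so induces $V_\star:\mathrm{Ho}(\mathcal M^I)\to\mathrm{Ho}(\mathcal M^V)$. The cone inclusion functor $\mathrm{Cone}:\mathrm{Ho}(\mathcal M^I)\to\mathrm{Ho}(\mathcal M^I)$ is $$\mathrm{Cone}(f)=\bigl(\mathrm{HoLKan}_{V\subset I\times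 I}\,V_\star(f)\bigr)\big|_{(0,1)<(1,1)},$$ where $\mathrm{HoLKan}_{V\subset I\times I}$ is the total left derived functor of the left Kan extension $\mathcal M^V\to\mathcal M^{I\times I}$. Thus $\mathrm{Cone}(X\to Y)$ is the map from $Y$ to the homotopy cofibre of $X\to Y$. For $f:X\to Y$ and $g:U\to W$ in $\mathcal M^I$ let $f\,\Box\,g: X\wedge W\sqcup_{X\wedge U}Y\wedge U\to Y\wedge W$ be the pushout smash product, and let $f\wedge_I g: X\wedge U\to Y\wedge W$ be the internal (vertex-wise) smash product. Then the left Kan extension $\mathcal M^V\to\mathcal M^{I\times I}$ and the functors $\Box,\wedge_I:\mathcal M^I\times\mathcal M^I\to\mathcal M^I$ have total left derived functors, the latter two being denoted $\Box^L,\wedge_I^L:\mathrm{Ho}(\mathcal M^I)\times\mathrm{Ho}(\mathcal M^I)\to\mathrm{Ho}(\mathcal M^I)$, and there is an isomorphism of functors $\mathrm{Ho}(\mathcal M^I)\times\mathrm{Ho}(\mathcal M^I)\to\mathrm{Ho}(\mathcal M^I)$ $$\mathrm{Cone}(-\,\Box^L-)\;\cong\;\mathrm{Cone}(-)\wedge_I^L\mathrm{Cone}(-).$$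 -/

import Mathlib

open CategoryTheory Limits HomotopicalAlgebra MonoidalCategory ZeroObject

universe v u

noncomputable section

namespace DiagramCone

/-- A monoidal model category: a closed monoidal structure on a model category with functorial
factorizations, satisfying the pushout-product axiom and the unit axiom. No symmetry is required,
so "closed" means that tensoring with an object on either side is a left adjoint. -/
class MonoidalModelCategory (M : Type u) [Category.{v} M] [ModelCategory M]
    [MonoidalCategory M] : Prop where
  tensorLeft_isLeftAdjoint (X : M) : (tensorLeft X).IsLeftAdjoint
  tensorRight_isLeftAdjoint (X : M) : (tensorRight X).IsLeftAdjoint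
  functorialFactorization_trivialCofibration :
    (trivialCofibrations M).HasFunctorialFactorization (fibrations M)
  functorialFactorization_trivialFibration :
    (cofibrations M).HasFunctorialFactorization (trivialFibrations M)
  cofibration_pushoutProduct (f g : Arrow M) :
    Cofibration f.hom → Cofibration g.hom →
      Cofibration ((MonoidalCategory.Arrow.pushoutProduct.obj f).obj g).hom
  weakEquivalence_pushoutProduct (f g : Arrow M) :
    Cofibration f.hom → Cofibration g.hom → WeakEquivalence f.hom ∨ WeakEquivalence g.hom →
      WeakEquivalence ((MonoidalCategory.Arrow.pushoutProduct.obj f).obj g).hom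
  unit_cofibrantReplacement :
    ∃ (QS : M) (q : QS ⟶ 𝟙_ M), IsCofibrant QS ∧ Fibration q ∧ WeakEquivalence q ∧
      ∀ X : M, IsCofibrant X → WeakEquivalence (q ▷ X) ∧ WeakEquivalence (X ◁ q)

/-! ### Homotopy categories of diagrams -/

section Ho

variable (M : Type u) [Category.{v} M] [ModelCategory M]

/-- The vertex-wise weak equivalences between diagrams of shape `J`. -/
abbrev diagW (J : Type) [Category.{0} J] : MorphismProperty (J ⥤ M) :=
  (weakEquivalences M).functorCategory J

instance (J : Type) [Category.{0} J] : (diagW M J).ContainsIdentities :=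
  ⟨fun _ _ => (weakEquivalences M).id_mem _⟩

/-- The homotopy category of diagrams of shape `J` in `M`. -/
abbrev Ho (J : Type) [Category.{0} J] := (diagW M J).Localization

/-- The localization functor from diagrams to the homotopy category of diagrams. -/
abbrev toHo (J : Type) [Category.{0} J] : (J ⥤ M) ⥤ Ho M J := (diagW M J).Q

end Ho

/-! ### The cone inclusion functor -/

/-- The poset `{0 < 1}`. -/
abbrev I : Type := Fin 2

/-- The condition on vertices of `I × I` defining the sub-poset `V`. -/
abbrev cornerProp : ObjectProperty (I × I) := fun p => p ≠ (1, 1)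

/-- The sub-poset of `I × I` with elements `(1, 0)`, `(0, 0)`, `(0, 1)`. -/
abbrev V : Type := cornerProp.FullSubcategory

/-- The inclusion of `V` in `I × I`. -/
abbrev cornerIncl : V ⥤ I × I := cornerProp.ι

instance : Finite V :=
  Finite.of_injective (fun p : V => p.obj) (fun p q h => by cases p; cases q; cases h; rfl)

instance (p q : I × I) : Subsingleton (p ⟶ q) :=
  ⟨fun _ _ => Prod.ext (Subsingleton.elim _ _) (Subsingleton.elim _ _)⟩

instance (p q : V) : Subsingleton (p ⟶ q) :=
  ⟨fun a b => InducedCategory.hom_ext (Subsingleton.elim a.hom b.hom)⟩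

instance (p : I × I) : Finite (CostructuredArrow cornerIncl p) :=
  Finite.of_injective (fun a => a.left) (by
    rintro ⟨a, ⟨⟨⟩⟩, (f : a.obj ⟶ p)⟩ ⟨b, ⟨⟨⟩⟩, (g : b.obj ⟶ p)⟩ h
    obtain rfl : a = b := h
    obtain rfl : f = g := Subsingleton.elim _ _
    rfl)

instance (p : I × I) (a b : CostructuredArrow cornerIncl p) : Subsingleton (a ⟶ b) :=
  ⟨fun _ _ => CostructuredArrow.hom_ext _ _ (Subsingleton.elim _ _)⟩

instance (p : I × I) : FinCategory (CostructuredArrow cornerIncl p) where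
  fintypeObj := Fintype.ofFinite _
  fintypeHom _ _ := Fintype.ofFinite _

section Cone

variable (M : Type u) [Category.{v} M]

instance [HasFiniteColimits M] (F : V ⥤ M) : cornerIncl.HasPointwiseLeftKanExtension F :=
  fun _ => inferInstanceAs (HasColimit _)

variable [HasZeroObject M] [HasZeroMorphisms M]

/-- The functor sending `f : X ⟶ Y` to the diagram of shape `V`
with `f` at the edge `(0, 0) ≤ (0, 1)` and the strict zero object at the vertex `(1, 0)`.
It is the restriction to `V` of the square `f ⟶ (0 ⟶ 0)`, the first coordinate of `I × I` being
the direction of this map of arrows. -/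
def starDiagram : (I ⥤ M) ⥤ (V ⥤ M) where
  obj f := cornerIncl ⋙ Functor.uncurry.obj
    (ComposableArrows.mk₁ (0 : f ⟶ (Functor.const I).obj (0 : M)))
  map φ := Functor.whiskerLeft cornerIncl (Functor.uncurry.map
    (ComposableArrows.homMk₁ φ (𝟙 _) (zero_comp.trans comp_zero.symm)))
  map_id f := by
    ext ⟨⟨i, j⟩, h⟩
    fin_cases i <;> rfl
  map_comp φ ψ := by
    ext ⟨⟨i, j⟩, h⟩
    fin_cases i
    · rfl
    · exact (Category.comp_id (𝟙 (0 : M))).symm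

end Cone

variable (M : Type u) [Category.{v} M] [ModelCategory M]

section

variable [HasZeroObject M] [HasZeroMorphisms M]

/-- `starDiagram` preserves vertex-wise weak equivalences. -/
def starLocalizerMorphism : LocalizerMorphism (diagW M I) (diagW M V) where
  functor := starDiagram M
  map := by
    rintro X Y φ hφ ⟨⟨i, j⟩, h⟩
    fin_cases i
    · exact hφ j
    · exact (weakEquivalences M).id_mem (0 : M)

/-- The functor `Ho(M^I) ⥤ Ho(M^V)` induced by `starDiagram`. -/
def starHo : Ho M I ⥤ Ho M V :=
  (starLocalizerMorphism M).localizedFunctor (toHo M I) (toHo M V)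

end

/-- Strict left Kan extension along `V ⊂ I × I`, with values in the homotopy category. -/
def cornerLan : (V ⥤ M) ⥤ Ho M (I × I) := cornerIncl.lan ⋙ toHo M (I × I)

/-- The left homotopy Kan extension along `V ⊂ I × I`:
the total left derived functor of the strict left Kan extension. -/
def cornerHoLan [(cornerLan M).HasLeftDerivedFunctor (diagW M V)] : Ho M V ⥤ Ho M (I × I) :=
  (cornerLan M).totalLeftDerived (toHo M V) (diagW M V)

/-- Restriction of squares to the edge `(0, 1) < (1, 1)`. -/
def edgeLocalizerMorphism : LocalizerMorphism (diagW M (I × I)) (diagW M I) where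
  functor := (Functor.whiskeringLeft I (I × I) M).obj (Prod.sectL I (1 : I))
  map _ _ _ hφ i := hφ (i, 1)

/-- The functor `Ho(M^(I × I)) ⥤ Ho(M^I)` restricting a square to the edge `(0, 1) < (1, 1)`. -/
def edgeHo : Ho M (I × I) ⥤ Ho M I :=
  (edgeLocalizerMorphism M).localizedFunctor (toHo M (I × I)) (toHo M I)

/-- The cone inclusion functor `Cone : Ho(M^I) ⥤ Ho(M^I)`, sending `f : X ⟶ Y` to `Y ⟶ cone f`:
the edge `(0, 1) < (1, 1)` of the left homotopy Kan extension of `0 ⟵ X ⟶ Y` to `I × I`. -/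
def coneInclusion [HasZeroObject M] [HasZeroMorphisms M]
    [(cornerLan M).HasLeftDerivedFunctor (diagW M V)] : Ho M I ⥤ Ho M I :=
  starHo M ⋙ cornerHoLan M ⋙ edgeHo M

/-! ### The derived pushout smash product and the derived internal smash product -/

section

variable (C : Type u) [Category.{v} C]

/-- A diagram of shape `I` as an object of the arrow category. -/
def diagramToArrow : (I ⥤ C) ⥤ Arrow C where
  obj f := Arrow.mk (f.map (homOfLE (by decide) : (0 : I) ⟶ 1))
  map φ := Arrow.homMk (φ.app 0) (φ.app 1) (φ.naturality _).symm

/-- An arrow as a diagram of shape `I`. -/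
def arrowToDiagram : Arrow C ⥤ (I ⥤ C) where
  obj f := ComposableArrows.mk₁ f.hom
  map φ := ComposableArrows.homMk₁ φ.left φ.right φ.w.symm
  map_id _ := ComposableArrows.hom_ext₁ rfl rfl
  map_comp _ _ := ComposableArrows.hom_ext₁ rfl rfl

end

variable [MonoidalCategory M]

/-- The strict pushout smash product `f □ g : X ∧ V ⊔_{X ∧ U} Y ∧ U ⟶ Y ∧ V` of
`f : X ⟶ Y` and `g : U ⟶ V`, as a functor of diagrams of shape `I`. -/
def box : (I ⥤ M) × (I ⥤ M) ⥤ (I ⥤ M) :=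
  (diagramToArrow M).prod (diagramToArrow M) ⋙
    Functor.uncurry.obj MonoidalCategory.Arrow.pushoutProduct ⋙ arrowToDiagram M

/-- The strict internal smash product on `M^I`, given vertex-wise by `(X ∧ Y) i = X i ∧ Y i`. -/
def smash : (I ⥤ M) × (I ⥤ M) ⥤ (I ⥤ M) := MonoidalCategory.tensor (I ⥤ M)

/-- A functor of two variables `M^I × M^I ⥤ M^I` has a total left derived functor. -/
abbrev HasDerived₂ (F : (I ⥤ M) × (I ⥤ M) ⥤ (I ⥤ M)) : Prop :=
  (F ⋙ toHo M I).HasLeftDerivedFunctor ((diagW M I).prod (diagW M I))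

/-- The total left derived functor `Ho(M^I) × Ho(M^I) ⥤ Ho(M^I)` of a functor
`M^I × M^I ⥤ M^I`. -/
def derived₂ (F : (I ⥤ M) × (I ⥤ M) ⥤ (I ⥤ M)) [HasDerived₂ M F] :
    Ho M I × Ho M I ⥤ Ho M I :=
  (F ⋙ toHo M I).totalLeftDerived ((toHo M I).prod (toHo M I)) ((diagW M I).prod (diagW M I))

end DiagramCone

end

/-! On sufficiently cofibrant arrows every functor involved is computed by its strict version, and
for the strict versions the claim is right exactness of the tensor product. The strict cone of `f :
X ⟶ Y` is the cokernel map `Y ⟶ Y/X`. If `π : Y ⟶ Z` and `π' : W ⟶ V` are cokernels of `f` and `g :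
U ⟶ W`, then `π ⊗ₘ π'` is a cokernel of `f □ g`, because tensoring on either side is a left adjoint
and so preserves cokernels (`isCoker_tensorHom`). Uniqueness of cokernels makes the resulting
isomorphism natural (`nonempty_box_strictCone_iso`). The two sides are treated separately, so no
symmetry enters.

For the passage to homotopy categories, resolve by cofibrations between cofibrant objects. The
pushout product keeps this class by the pushout-product axiom and respects weak equivalences in it
by the gluing lemma `weakEquivalence_of_span`. The Kan extension adds a single pushout to a span, so
the same lemma derives it. Cones of such arrows are vertex-wise cofibrant, which is enough for the
internal smash product by Ken Brown's lemma. Each derived composite therefore maps to its strict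
counterpart by a transformation invertible on resolving objects, and `LeftDeformation.nonempty_iso`
transports the strict isomorphism. -/

noncomputable section

namespace DiagramCone

/-! ### The gluing lemma in a model category. -/

section Gluing

variable {M : Type u} [Category.{v} M] [ModelCategory M]

lemma cofibration_of_isPushout {A B C P : M} {f : A ⟶ B} {g : A ⟶ C} {h : B ⟶ P} {k : C ⟶ P}
    (sq : IsPushout f g h k) [hg : Cofibration g] : Cofibration h := by
  rw [cofibration_iff] at hg ⊢
  exact MorphismProperty.of_isPushout sq hg

lemma weakEquivalence_of_isPushout {A B C P : M} {f : A ⟶ B} {g : A ⟶ C} {h : B ⟶ P} {k : C ⟶ P}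
    (sq : IsPushout f g h k) [Cofibration g] [WeakEquivalence g] : WeakEquivalence h := by
  rw [weakEquivalence_iff]
  exact (MorphismProperty.of_isPushout (P := trivialCofibrations M) sq
    (mem_trivialCofibrations g)).2

/-- The gluing lemma for trivial cofibrations of spans, in the Reedy sense. -/
lemma weakEquivalence_of_reedy_trivialCofibration
    {A B C P A' B' C' P' D : M}
    {f : A ⟶ B} {g : A ⟶ C} {h : B ⟶ P} {k : C ⟶ P} (sq : IsPushout f g h k)
    {f' : A' ⟶ B'} {g' : A' ⟶ C'} {h' : B' ⟶ P'} {k' : C' ⟶ P'} (sq' : IsPushout f' g' h' k')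
    {α : A ⟶ A'} {β : B ⟶ B'} {γ : C ⟶ C'} {π : P ⟶ P'}
    (wf : f ≫ β = α ≫ f') (wh : h ≫ π = β ≫ h') (wk : k ≫ π = γ ≫ k')
    {a : A' ⟶ D} {c : C ⟶ D} (sqD : IsPushout α g a c) {δ : D ⟶ C'}
    (ha : a ≫ δ = g') (hc : c ≫ δ = γ)
    [Cofibration α] [WeakEquivalence α] [Cofibration β] [WeakEquivalence β]
    [Cofibration δ] [WeakEquivalence γ] : WeakEquivalence π := by
  have : WeakEquivalence c := weakEquivalence_of_isPushout sqD.flip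
  have : WeakEquivalence δ := weakEquivalence_of_precomp_of_fac hc
  -- `E = P ⊔_B B'` splits `π` in two: `P ⟶ E` is a pushout of `β`. Pasting shows that `E` is also
  -- `B' ⊔_{A'} D`, so `E ⟶ P'` is a pushout of `δ`.
  obtain ⟨E, i, j, sqE⟩ : ∃ (E : M) (i : P ⟶ E) (j : B' ⟶ E), IsPushout h β i j :=
    ⟨_, _, _, IsPushout.of_hasPushout h β⟩
  have : WeakEquivalence i := weakEquivalence_of_isPushout sqE
  have big : IsPushout (α ≫ f') g j (k ≫ i) := by
    rw [← wf]
    exact (sq.flip.paste_vert sqE).flip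
  have big_w : α ≫ f' ≫ j = g ≫ k ≫ i := by simpa using big.w
  have sqF : IsPushout f' a j (sqD.desc (f' ≫ j) (k ≫ i) big_w) :=
    IsPushout.of_left (h₁₁ := α) (v₁₁ := g) (h₂₁ := c) (by simpa using big) (by simp) sqD
  have hp : sqD.desc (f' ≫ j) (k ≫ i) big_w ≫ sqE.desc π h' wh = δ ≫ k' := by
    apply sqD.hom_ext
    · simp [reassoc_of% ha, sq'.w]
    · simp [reassoc_of% hc, wk]
  have sqG : IsPushout (sqD.desc (f' ≫ j) (k ≫ i) big_w) δ (sqE.desc π h' wh) k' :=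
    IsPushout.of_top (h₁₁ := f') (v₁₁ := a) (v₁₂ := j) (by simpa [ha] using sq') hp sqF
  have : WeakEquivalence (sqE.desc π h' wh) := weakEquivalence_of_isPushout sqG
  rw [← sqE.inl_desc π h' wh]
  infer_instance

/-- The gluing lemma: the pushout of a cofibration between cofibrant objects along a morphism
to a cofibrant object is invariant under weak equivalences. -/
theorem weakEquivalence_of_span {A B C P A' B' C' P' : M}
    {f : A ⟶ B} {g : A ⟶ C} {h : B ⟶ P} {k : C ⟶ P} (sq : IsPushout f g h k)
    {f' : A' ⟶ B'} {g' : A' ⟶ C'} {h' : B' ⟶ P'} {k' : C' ⟶ P'} (sq' : IsPushout f' g' h' k')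
    {α : A ⟶ A'} {β : B ⟶ B'} {γ : C ⟶ C'} {π : P ⟶ P'}
    (wf : f ≫ β = α ≫ f') (wg : g ≫ γ = α ≫ g') (wh : h ≫ π = β ≫ h') (wk : k ≫ π = γ ≫ k')
    [IsCofibrant A] [IsCofibrant A'] [IsCofibrant B] [IsCofibrant B']
    [Cofibration g] [Cofibration g']
    [WeakEquivalence α] [WeakEquivalence β] [WeakEquivalence γ] : WeakEquivalence π := by
  -- a cylinder factorization of `α`
  let dA := MorphismProperty.factorizationData (cofibrations M) (trivialFibrations M)
    (coprod.desc α (𝟙 A'))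
  have : Cofibration dA.i := ⟨dA.hi⟩
  have : WeakEquivalence dA.p := ⟨dA.hp.2⟩
  let iA : A ⟶ dA.Z := coprod.inl ≫ dA.i
  let sA : A' ⟶ dA.Z := coprod.inr ≫ dA.i
  have iA_p : iA ≫ dA.p = α :=
    (by simp only [iA, Category.assoc, dA.fac]; exact coprod.inl_desc _ _)
  have sA_p : sA ≫ dA.p = 𝟙 A' :=
    (by simp only [sA, Category.assoc, dA.fac]; exact coprod.inr_desc _ _)
  have : WeakEquivalence iA := weakEquivalence_of_postcomp_of_fac iA_p
  have : WeakEquivalence sA := weakEquivalence_of_postcomp_of_fac sA_p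
  have : Cofibration iA := inferInstanceAs (Cofibration (coprod.inl ≫ dA.i))
  have : Cofibration sA := inferInstanceAs (Cofibration (coprod.inr ≫ dA.i))
  -- the leg without cofibrations
  obtain ⟨TB, tB, uB, sqB⟩ : ∃ (T : M) (t : B ⨿ B' ⟶ T) (u : dA.Z ⟶ T),
      IsPushout (coprod.map f f') dA.i t u := ⟨_, _, _, IsPushout.of_hasPushout _ _⟩
  have : Cofibration tB := cofibration_of_isPushout sqB
  let dB := MorphismProperty.factorizationData (cofibrations M) (trivialFibrations M)
    (sqB.desc (coprod.desc β (𝟙 B')) (dA.p ≫ f') (by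
      ext
      · simp [wf]
      · simpa [sA] using (coprod.inr_desc _ _).trans (sA_p =≫ f').symm))
  have : Cofibration dB.i := ⟨dB.hi⟩
  have : WeakEquivalence dB.p := ⟨dB.hp.2⟩
  let iB : B ⟶ dB.Z := coprod.inl ≫ tB ≫ dB.i
  let sB : B' ⟶ dB.Z := coprod.inr ≫ tB ≫ dB.i
  have iB_p : iB ≫ dB.p = β :=
    (by simp only [iB, Category.assoc, dB.fac, sqB.inl_desc]; exact coprod.inl_desc _ _)
  have sB_p : sB ≫ dB.p = 𝟙 B' :=
    (by simp only [sB, Category.assoc, dB.fac, sqB.inl_desc]; exact coprod.inr_desc _ _)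
  have : WeakEquivalence iB := weakEquivalence_of_postcomp_of_fac iB_p
  have : WeakEquivalence sB := weakEquivalence_of_postcomp_of_fac sB_p
  have : Cofibration iB := inferInstanceAs (Cofibration (coprod.inl ≫ tB ≫ dB.i))
  have : Cofibration sB := inferInstanceAs (Cofibration (coprod.inr ≫ tB ≫ dB.i))
  let f'' : dA.Z ⟶ dB.Z := uB ≫ dB.i
  have f''_p : f'' ≫ dB.p = dA.p ≫ f' := by simp [f'']
  have iB_f : f ≫ iB = iA ≫ f'' := by
    simp [iB, iA, f'', ← reassoc_of% sqB.w]
  have sB_f : f' ≫ sB = sA ≫ f'' := by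
    simp [sB, sA, f'', ← reassoc_of% sqB.w]
  -- the leg with cofibrations
  obtain ⟨D, aD, cD, sqD⟩ : ∃ (D : M) (a : dA.Z ⟶ D) (c : C ⟶ D),
      IsPushout iA g a c := ⟨_, _, _, IsPushout.of_hasPushout _ _⟩
  -- `T` attaches `C` and `C'` to the cylinder one after the other. Then `D ⟶ T` is a pushout of
  -- `g'` and `D' ⟶ T` is a pushout of `g`, which gives the relative cofibration needed at each end.
  obtain ⟨T, t, e, sqT⟩ : ∃ (T : M) (t : D ⟶ T) (e : C' ⟶ T),
      IsPushout (sA ≫ aD) g' t e := ⟨_, _, _, IsPushout.of_hasPushout _ _⟩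
  obtain ⟨D', aD', cD', sqD'⟩ : ∃ (D' : M) (a : dA.Z ⟶ D') (c : C' ⟶ D'),
      IsPushout sA g' a c := ⟨_, _, _, IsPushout.of_hasPushout _ _⟩
  have wT : sA ≫ aD ≫ t = g' ≫ e := by simpa using sqT.w
  have sqT' : IsPushout aD aD' t (sqD'.desc (aD ≫ t) e wT) :=
    IsPushout.of_left (h₁₁ := sA) (v₁₁ := g') (h₂₁ := cD') (by simpa using sqT) (by simp) sqD'
  have : Cofibration (sqD'.desc (aD ≫ t) e wT) :=
    cofibration_of_isPushout (sqD.paste_horiz sqT'.flip)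
  have : Cofibration t := cofibration_of_isPushout sqT
  let dC := MorphismProperty.factorizationData (cofibrations M) (trivialFibrations M)
    (sqT.desc (sqD.desc (dA.p ≫ g') γ (by simp [reassoc_of% iA_p, wg])) (𝟙 C') (by
      simp [reassoc_of% sA_p]))
  have : Cofibration dC.i := ⟨dC.hi⟩
  have : WeakEquivalence dC.p := ⟨dC.hp.2⟩
  let g'' : dA.Z ⟶ dC.Z := aD ≫ t ≫ dC.i
  let iC : C ⟶ dC.Z := cD ≫ t ≫ dC.i
  let sC : C' ⟶ dC.Z := e ≫ dC.i
  have iC_p : iC ≫ dC.p = γ := by simp [iC]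
  have sC_p : sC ≫ dC.p = 𝟙 C' := by simp [sC]
  have g''_p : g'' ≫ dC.p = dA.p ≫ g' := by simp [g'']
  have : WeakEquivalence iC := weakEquivalence_of_postcomp_of_fac iC_p
  have : WeakEquivalence sC := weakEquivalence_of_postcomp_of_fac sC_p
  have iC_g : g ≫ iC = iA ≫ g'' := by simp [iC, g'', reassoc_of% sqD.w]
  have sC_g : g' ≫ sC = sA ≫ g'' := by simp [sC, g'', ← reassoc_of% wT]
  -- comparison of the pushouts
  obtain ⟨P'', h'', k'', sq''⟩ : ∃ (P'' : M) (h'' : dB.Z ⟶ P'') (k'' : dC.Z ⟶ P''),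
      IsPushout f'' g'' h'' k'' := ⟨_, _, _, IsPushout.of_hasPushout _ _⟩
  -- Ken Brown's argument for spans: both ends include by Reedy trivial cofibrations, so `π₁` and
  -- `σ` are weak equivalences; `π₂` retracts `σ`, and `π = π₁ ≫ π₂`.
  let π₁ : P ⟶ P'' := sq.desc (iB ≫ h'') (iC ≫ k'')
    (by rw [← Category.assoc, iB_f, Category.assoc, sq''.w, ← Category.assoc, ← iC_g,
      Category.assoc])
  let σ : P' ⟶ P'' := sq'.desc (sB ≫ h'') (sC ≫ k'')
    (by rw [← Category.assoc, sB_f, Category.assoc, sq''.w, ← Category.assoc, ← sC_g,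
      Category.assoc])
  let π₂ : P'' ⟶ P' := sq''.desc (dB.p ≫ h') (dC.p ≫ k')
    (by
      have h₁ := f''_p =≫ h'
      have h₂ := g''_p =≫ k'
      simp only [Category.assoc] at h₁ h₂
      rw [h₁, h₂, sq'.w])
  have : WeakEquivalence π₁ :=
    weakEquivalence_of_reedy_trivialCofibration sq sq'' iB_f (by simp [π₁]) (by simp [π₁]) sqD
      (γ := iC) (δ := t ≫ dC.i) rfl rfl
  have : WeakEquivalence σ :=
    weakEquivalence_of_reedy_trivialCofibration sq' sq'' sB_f (by simp [σ]) (by simp [σ]) sqD'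
      (γ := sC)
      (δ := sqD'.desc (aD ≫ t) e wT ≫ dC.i) (by simp [g'']) (by simp [sC])
  have hσ : σ ≫ π₂ = 𝟙 P' := by
    apply sq'.hom_ext
    · simp [σ, π₂, reassoc_of% sB_p]
    · simp [σ, π₂, reassoc_of% sC_p]
  have : WeakEquivalence π₂ := weakEquivalence_of_precomp_of_fac hσ
  have hπ : π = π₁ ≫ π₂ := by
    apply sq.hom_ext
    · simp [π₁, π₂, wh, reassoc_of% iB_p]
    · simp [π₁, π₂, wk, reassoc_of% iC_p]
  rw [hπ]
  infer_instance

end Gluing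

/-! ### Derived functors from functorial resolutions. -/

section Deformation

variable {C D H : Type*} [Category* C] [Category* D] [Category* H]

/-- A left deformation: functorial resolutions by objects satisfying `P`. -/
structure LeftDeformation (W : MorphismProperty C) (P : ObjectProperty C) where
  /-- the resolution functor -/
  Q : C ⥤ C
  /-- the augmentation -/
  q : Q ⟶ 𝟭 C
  prop_obj (X : C) : P (Q.obj X)
  weq_app (X : C) : W (q.app X)

namespace LeftDeformation

variable {W : MorphismProperty C} {P : ObjectProperty C}

/-- Enlarging the class of resolving objects. -/
def ofLE (d : LeftDeformation W P) {P' : ObjectProperty C} (h : P ≤ P') :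
    LeftDeformation W P' where
  Q := d.Q
  q := d.q
  prop_obj X := h _ (d.prop_obj X)
  weq_app := d.weq_app

/-- The product of two left deformations. -/
def prod {C' : Type*} [Category* C'] {W' : MorphismProperty C'} {P' : ObjectProperty C'}
    (d : LeftDeformation W P) (d' : LeftDeformation W' P') :
    LeftDeformation (W.prod W') (fun X => P X.1 ∧ P' X.2) where
  Q := d.Q.prod d'.Q
  q := { app X := (d.q.app X.1, d'.q.app X.2)
         naturality _ _ f := Prod.ext (d.q.naturality f.1) (d'.q.naturality f.2) }
  prop_obj X := ⟨d.prop_obj X.1, d'.prop_obj X.2⟩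
  weq_app X := ⟨d.weq_app X.1, d'.weq_app X.2⟩

variable (d : LeftDeformation W P)

lemma map_weq [W.HasTwoOutOfThreeProperty] {X Y : C} (f : X ⟶ Y) (hf : W f) :
    W (d.Q.map f) := by
  have h := d.q.naturality f
  dsimp at h
  rw [← W.postcomp_iff _ _ (d.weq_app Y), h]
  exact W.comp_mem _ _ (d.weq_app X) hf

variable (L : C ⥤ D) [L.IsLocalization W]

include d in
lemma isIso_map_app (X : C) : IsIso (L.map (d.q.app X)) :=
  Localization.inverts L W _ (d.weq_app X)

instance isIso_whiskerRight (G : D ⥤ H) : IsIso (Functor.whiskerRight d.q (L ⋙ G)) :=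
  have (X : C) : IsIso ((Functor.whiskerRight d.q (L ⋙ G)).app X) := by
    have := d.isIso_map_app L X
    dsimp
    infer_instance
  NatIso.isIso_of_isIso_app _

include d in
variable {L} in
/-- A natural transformation out of a functor on the localized category is determined on the
resolving objects. -/
lemma natTrans_ext {G G' : D ⥤ H} {γ γ' : G ⟶ G'}
    (h : ∀ X, P X → γ.app (L.obj X) = γ'.app (L.obj X)) : γ = γ' := by
  apply Localization.natTrans_ext L W
  intro X
  have := d.isIso_map_app L X
  rw [← cancel_epi (G.map (L.map (d.q.app X)))]
  exact (γ.naturality _).trans ((h _ (d.prop_obj X) =≫ _).trans (γ'.naturality _).symm)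

include d in
/-- Two functors on the localized category that agree on the resolving objects with isomorphic
functors are isomorphic. -/
lemma nonempty_iso {F : C ⥤ H} {H₁ H₂ : D ⥤ H} (α₁ : L ⋙ H₁ ⟶ F) (α₂ : L ⋙ H₂ ⟶ F)
    (h₁ : ∀ X, P X → IsIso (α₁.app X)) (h₂ : ∀ X, P X → IsIso (α₂.app X)) :
    Nonempty (H₁ ≅ H₂) := by
  -- Everything is compared with `d.Q ⋙ F`: `L` inverts the augmentation `q`, and `α` is invertible
  -- on the values of `d.Q`.
  have key (K : D ⥤ H) (α : L ⋙ K ⟶ F) (h : ∀ X, P X → IsIso (α.app X)) :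
      Nonempty (L ⋙ K ≅ d.Q ⋙ F) := by
    have := d.isIso_whiskerRight L K
    have : ∀ X, IsIso ((Functor.whiskerLeft d.Q α).app X) := fun X => h _ (d.prop_obj X)
    have : IsIso (Functor.whiskerLeft d.Q α) := NatIso.isIso_of_isIso_app _
    exact ⟨(Functor.leftUnitor _).symm ≪≫ (asIso (Functor.whiskerRight d.q (L ⋙ K))).symm ≪≫
      asIso (Functor.whiskerLeft d.Q α)⟩
  obtain ⟨e₁⟩ := key H₁ α₁ h₁
  obtain ⟨e₂⟩ := key H₂ α₂ h₂
  exact ⟨Localization.liftNatIso L W _ _ H₁ H₂ (e₁ ≪≫ e₂.symm)⟩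

variable [W.HasTwoOutOfThreeProperty]
  {F : C ⥤ H} (hF : ∀ ⦃X Y : C⦄ (f : X ⟶ Y), P X → P Y → W f → IsIso (F.map f))

include hF in
lemma inverts : W.IsInvertedBy (d.Q ⋙ F) := fun _ _ f hf =>
  hF _ (d.prop_obj _) (d.prop_obj _) (d.map_weq f hf)

/-- The left derived functor given by a left deformation. -/
def derived : D ⥤ H := Localization.lift (d.Q ⋙ F) (d.inverts hF) L

/-- The isomorphism computing the left derived functor given by a left deformation. -/
def derivedIso : L ⋙ d.derived L hF ≅ d.Q ⋙ F := Localization.fac _ _ _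

instance : Localization.Lifting L W (d.Q ⋙ F) (d.derived L hF) := ⟨d.derivedIso L hF⟩

/-- The counit of the left derived functor given by a left deformation. -/
def derivedCounit : L ⋙ d.derived L hF ⟶ F :=
  (d.derivedIso L hF).hom ≫ Functor.whiskerRight d.q F

lemma isIso_derivedCounit_app {X : C} (hX : P X) : IsIso ((d.derivedCounit L hF).app X) := by
  have := hF (d.q.app X) (d.prop_obj X) hX (d.weq_app X)
  dsimp [derivedCounit]
  infer_instance

/-- The factorization of a natural transformation through the derived functor. -/
def derivedLift {G : D ⥤ H} (β : L ⋙ G ⟶ F) : G ⟶ d.derived L hF :=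
  Localization.liftNatTrans L W (L ⋙ G) (d.Q ⋙ F) G (d.derived L hF)
    ((Functor.leftUnitor (L ⋙ G)).inv ≫ inv (Functor.whiskerRight d.q (L ⋙ G)) ≫
      Functor.whiskerLeft d.Q β)

lemma derivedLift_fac {G : D ⥤ H} (β : L ⋙ G ⟶ F) :
    Functor.whiskerLeft L (d.derivedLift L hF β) ≫ d.derivedCounit L hF = β := by
  ext X
  have := d.isIso_map_app L X
  have h : inv (G.map (L.map (d.q.app X))) ≫ β.app (d.Q.obj X) ≫ F.map (d.q.app X) = β.app X := by
    rw [IsIso.inv_comp_eq]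
    exact (β.naturality (d.q.app X)).symm
  have e : (Localization.Lifting.iso L W (d.Q ⋙ F) (d.derived L hF)).inv.app X ≫
      (d.derivedIso L hF).hom.app X = 𝟙 _ := (d.derivedIso L hF).inv_hom_id_app X
  simp only [derivedLift, derivedCounit, NatTrans.comp_app, Functor.whiskerLeft_app,
    Localization.liftNatTrans_app, Category.assoc, reassoc_of% e, NatIso.isIso_inv_app,
    Functor.whiskerRight_app]
  simpa using h

/-- Uniqueness of the factorization need only be tested on resolving objects, where the counit is
invertible and can be cancelled. -/
instance isLeftDerivedFunctor_derived :
    (d.derived L hF).IsLeftDerivedFunctor (d.derivedCounit L hF) W where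
  isRightKanExtension := ⟨⟨IsTerminal.ofUniqueHom
    (fun G => CostructuredArrow.homMk (d.derivedLift L hF G.hom) (d.derivedLift_fac L hF G.hom))
    (fun G γ => by
      apply CostructuredArrow.hom_ext
      apply d.natTrans_ext (L := L)
      intro X hX
      have := d.isIso_derivedCounit_app L hF hX
      apply (cancel_mono ((d.derivedCounit L hF).app X)).1
      exact (NatTrans.congr_app (CostructuredArrow.w γ) X).trans
        (NatTrans.congr_app (d.derivedLift_fac L hF G.hom) X).symm)⟩⟩

include d hF in
lemma hasLeftDerivedFunctor : F.HasLeftDerivedFunctor W :=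
  have := d.isLeftDerivedFunctor_derived W.Q hF
  Functor.HasLeftDerivedFunctor.mk' _ (d.derivedCounit W.Q hF)

include d hF in
-- `totalLeftDerived` is an unspecified choice; uniqueness of derived functors, compatibly with
-- counits, transfers to it what is known for `derived`.
lemma isIso_app_of_isLeftDerivedFunctor {LF : D ⥤ H} (α : L ⋙ LF ⟶ F)
    [LF.IsLeftDerivedFunctor α W] {X : C} (hX : P X) : IsIso (α.app X) := by
  have := d.isLeftDerivedFunctor_derived L hF
  have h := Functor.leftDerivedNatTrans_app LF (d.derived L hF) α (d.derivedCounit L hF) W (𝟙 F) X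
  have := d.isIso_derivedCounit_app L hF hX
  have : IsIso (Functor.leftDerivedNatTrans LF (d.derived L hF) α (d.derivedCounit L hF) W (𝟙 F)) :=
    (Functor.leftDerivedNatIso LF (d.derived L hF) α (d.derivedCounit L hF) W
      (Iso.refl F)).isIso_hom
  rw [NatTrans.id_app, Category.comp_id] at h
  rw [← h]
  infer_instance

end LeftDeformation

end Deformation

/-! ### Diagrams of shape `V`. -/

section Shapes

/-- The edge of the poset `{0 < 1}`. -/
abbrev edgeI : (0 : I) ⟶ 1 := homOfLE (by decide)

/-- The initial vertex of `V`. -/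
abbrev v₀₀ : V := ⟨(0, 0), by decide⟩

/-- The vertex `(0, 1)` of `V`. -/
abbrev v₀₁ : V := ⟨(0, 1), by decide⟩

/-- The vertex `(1, 0)` of `V`. -/
abbrev v₁₀ : V := ⟨(1, 0), by decide⟩

/-- The edge `(0, 0) ≤ (0, 1)` of `V`. -/
abbrev e₀₁ : v₀₀ ⟶ v₀₁ := ObjectProperty.homMk (show ((0, 0) : I × I) ⟶ (0, 1) from (𝟙 _, edgeI))

/-- The edge `(0, 0) ≤ (1, 0)` of `V`. -/
abbrev e₁₀ : v₀₀ ⟶ v₁₀ := ObjectProperty.homMk (show ((0, 0) : I × I) ⟶ (1, 0) from (edgeI, 𝟙 _))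

lemma forall_V {p : V → Prop} (h₀₀ : p v₀₀) (h₀₁ : p v₀₁) (h₁₀ : p v₁₀) (v : V) : p v := by
  obtain ⟨⟨i, j⟩, h⟩ := v
  fin_cases i <;> fin_cases j
  · exact h₀₀
  · exact h₀₁
  · exact h₁₀
  · exact absurd rfl h

variable {N : Type*} [Category* N]

/-- Natural transformations between diagrams of shape `V`. -/
def natTransV {F G : V ⥤ N} (a : F.obj v₀₀ ⟶ G.obj v₀₀) (b : F.obj v₁₀ ⟶ G.obj v₁₀)
    (c : F.obj v₀₁ ⟶ G.obj v₀₁) (hb : F.map e₁₀ ≫ b = a ≫ G.map e₁₀)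
    (hc : F.map e₀₁ ≫ c = a ≫ G.map e₀₁) : F ⟶ G where
  app v := match v with
    | ⟨(0, 0), _⟩ => a
    | ⟨(0, 1), _⟩ => c
    | ⟨(1, 0), _⟩ => b
    | ⟨(1, 1), h⟩ => absurd rfl h
  naturality := by
    have hid {v : V} (f : v ⟶ v) : f = 𝟙 v := Subsingleton.elim _ _
    refine forall_V (forall_V ?_ ?_ ?_) (forall_V ?_ ?_ ?_) (forall_V ?_ ?_ ?_) <;> intro f
    · rw [hid f]; simp
    · exact hc
    · exact hb
    · exact absurd (leOfHom f.hom.2) (by decide)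
    · rw [hid f]; simp
    · exact absurd (leOfHom f.hom.2) (by decide)
    · exact absurd (leOfHom f.hom.1) (by decide)
    · exact absurd (leOfHom f.hom.1) (by decide)
    · rw [hid f]; simp

variable {A B C : N} [HasTerminal N]

/-- The diagram of shape `V` attached to a span. -/
def spanV (f : A ⟶ B) (g : A ⟶ C) : V ⥤ N :=
  -- The terminal object only fills the fourth vertex of a square, which `V` omits.
  cornerIncl ⋙ Functor.uncurry.obj (ComposableArrows.mk₁
    (ComposableArrows.homMk₁ f (terminal.from C)
      (terminal.hom_ext (g ≫ terminal.from C) (f ≫ terminal.from B)) :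
      ComposableArrows.mk₁ g ⟶ ComposableArrows.mk₁ (terminal.from B)))

lemma spanV_map_e₀₁ (f : A ⟶ B) (g : A ⟶ C) : (spanV f g).map e₀₁ = g :=
  Category.id_comp g

lemma spanV_map_e₁₀ (f : A ⟶ B) (g : A ⟶ C) : (spanV f g).map e₁₀ = f :=
  Category.comp_id f

end Shapes

/-! ### Functorial cofibrant resolutions of arrows and spans. -/

section Resolutions

variable {N : Type*} [Category* N] (C W : MorphismProperty N) [C.HasFactorization W]

/-- The ambient category is arbitrary so that it can be a category of functors to `M`: there an
ordinary factorization is a functorial factorization in `M`. -/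
lemma exists_resolution_I (F : I ⥤ N) (O : N) (o : O ⟶ F.obj 0) :
    ∃ (G : I ⥤ N) (φ : G ⟶ F) (o' : O ⟶ G.obj 0), (∀ i, W (φ.app i)) ∧ C o' ∧
      C (G.map edgeI) := by
  let d := MorphismProperty.factorizationData C W o
  let d' := MorphismProperty.factorizationData C W (d.p ≫ F.map edgeI)
  refine ⟨ComposableArrows.mk₁ d'.i, ComposableArrows.homMk₁ d.p d'.p d'.fac, d.i, ?_, d.hi, d'.hi⟩
  intro i
  fin_cases i
  · exact d.hp
  · exact d'.hp

lemma exists_resolution_V [HasTerminal N] (F : V ⥤ N) (O : N) (o : O ⟶ F.obj v₀₀) :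
    ∃ (G : V ⥤ N) (φ : G ⟶ F) (o' : O ⟶ G.obj v₀₀), (∀ i, W (φ.app i)) ∧ C o' ∧
      C (G.map e₀₁) ∧ C (G.map e₁₀) := by
  let d := MorphismProperty.factorizationData C W o
  let d₁ := MorphismProperty.factorizationData C W (d.p ≫ F.map e₀₁)
  let d₂ := MorphismProperty.factorizationData C W (d.p ≫ F.map e₁₀)
  refine ⟨spanV d₂.i d₁.i, natTransV d.p d₂.p d₁.p ?_ ?_, d.i, ?_, d.hi, ?_, ?_⟩
  · rw [spanV_map_e₁₀]; exact d₂.fac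
  · rw [spanV_map_e₀₁]; exact d₁.fac
  · exact forall_V d.hp d₁.hp d₂.hp
  · rw [spanV_map_e₀₁]; exact d₁.hi
  · rw [spanV_map_e₁₀]; exact d₂.hi

variable (M : Type u) [Category.{v} M] [ModelCategory M]

/-- The arrows that are cofibrations between cofibrant objects. -/
def cofibrantArrows : ObjectProperty (I ⥤ M) := fun f =>
  IsCofibrant (f.obj 0) ∧ IsCofibrant (f.obj 1) ∧ Cofibration (f.map edgeI)

/-- The diagrams of shape `V` of cofibrant objects whose edge `(0, 0) ≤ (0, 1)`
is a cofibration. -/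
def cofibrantSpans : ObjectProperty (V ⥤ M) := fun F =>
  (∀ v, IsCofibrant (F.obj v)) ∧ Cofibration (F.map e₀₁)

variable [(cofibrations M).HasFunctorialFactorization (trivialFibrations M)]

/-- A functorial resolution of all arrows is one resolution of the universal arrow, the flipped
identity, formed by the two evaluation functors. -/
lemma exists_leftDeformation_I : Nonempty (LeftDeformation (diagW M I) (cofibrantArrows M)) := by
  obtain ⟨G, φ, o, hφ, ho, hG⟩ := exists_resolution_I
    ((cofibrations M).functorCategory (I ⥤ M)) ((trivialFibrations M).functorCategory (I ⥤ M))
    (𝟭 (I ⥤ M)).flip ((Functor.const _).obj (⊥_ M)) { app _ := initial.to _ }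
  refine ⟨G.flip, (flipFunctor _ _ _).map φ, fun X => ?_, fun X i => (hφ i X).2⟩
  have h₀ : IsCofibrant ((G.obj 0).obj X) :=
    (isCofibrant_iff_of_isInitial (o.app X) initialIsInitial).2 ⟨ho X⟩
  have h : Cofibration ((G.map edgeI).app X) := ⟨hG X⟩
  exact ⟨h₀, isCofibrant_of_cofibration ((G.map edgeI).app X), h⟩

/-- The resolution makes both legs cofibrations, but the class `cofibrantSpans` demands only one, so
that it can contain spans `0 ⟵ X ⟶ Y`, whose leg `X ⟶ 0` is rarely a cofibration. -/
lemma exists_leftDeformation_V : Nonempty (LeftDeformation (diagW M V) (cofibrantSpans M)) := by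
  obtain ⟨G, φ, o, hφ, ho, hG, hG'⟩ := exists_resolution_V
    ((cofibrations M).functorCategory (V ⥤ M)) ((trivialFibrations M).functorCategory (V ⥤ M))
    (𝟭 (V ⥤ M)).flip ((Functor.const _).obj (⊥_ M)) { app _ := initial.to _ }
  refine ⟨G.flip, (flipFunctor _ _ _).map φ, fun X => ?_, fun X i => (hφ i X).2⟩
  have h₀ : IsCofibrant ((G.obj v₀₀).obj X) :=
    (isCofibrant_iff_of_isInitial (o.app X) initialIsInitial).2 ⟨ho X⟩
  have h : Cofibration ((G.map e₀₁).app X) := ⟨hG X⟩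
  have h' : Cofibration ((G.map e₁₀).app X) := ⟨hG' X⟩
  exact ⟨forall_V h₀ (isCofibrant_of_cofibration ((G.map e₀₁).app X))
    (isCofibrant_of_cofibration ((G.map e₁₀).app X)), h⟩

end Resolutions

/-! ### The left Kan extension along `V ⊂ I × I` as a pushout. -/

section Corner

variable {M : Type u} [Category.{v} M] [HasFiniteColimits M]

/-- The morphisms to the terminal vertex of `I × I`. -/
abbrev toTop (p : I × I) : p ⟶ (1, 1) :=
  (homOfLE (Fin.le_last p.1), homOfLE (Fin.le_last p.2))

/-- Since `(1, 1)` is terminal, a morphism out of the value there is the same as a transformation to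
a constant diagram, and such transformations are determined on `V`. -/
lemma lan_hom_ext (F : V ⥤ M) {T : M} {g g' : (cornerIncl.lan.obj F).obj (1, 1) ⟶ T}
    (h : ∀ v : V, (cornerIncl.lanUnit.app F).app v ≫ (cornerIncl.lan.obj F).map (toTop v.obj) ≫ g =
      (cornerIncl.lanUnit.app F).app v ≫ (cornerIncl.lan.obj F).map (toTop v.obj) ≫ g') :
    g = g' := by
  let γ (k : (cornerIncl.lan.obj F).obj (1, 1) ⟶ T) :
      cornerIncl.lan.obj F ⟶ (Functor.const _).obj T :=
    { app p := (cornerIncl.lan.obj F).map (toTop p) ≫ k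
      naturality p p' f := by
        rw [← Category.assoc, ← Functor.map_comp, Subsingleton.elim (f ≫ toTop p') (toTop p)]
        exact (Category.comp_id _).symm }
  have h' : γ g = γ g' := Functor.hom_ext_of_isLeftKanExtension _ (cornerIncl.lanUnit.app F) _ _
    (by ext v; exact h v)
  have := NatTrans.congr_app h' (1, 1)
  have e : toTop (1, 1) = 𝟙 _ := Subsingleton.elim _ _
  simpa [γ, e] using this

/-- A cocone under the span is a transformation from `F` to a constant diagram; the universal
property of the Kan extension extends it over `I × I`, and its component at `(1, 1)` is the required
map. -/
lemma isPushout_lan (F : V ⥤ M) : IsPushout (F.map e₁₀) (F.map e₀₁)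
    ((cornerIncl.lanUnit.app F).app v₁₀ ≫ (cornerIncl.lan.obj F).map (toTop v₁₀.obj))
    ((cornerIncl.lanUnit.app F).app v₀₁ ≫ (cornerIncl.lan.obj F).map (toTop v₀₁.obj)) := by
  have w {v : V} (e : v₀₀ ⟶ v) : F.map e ≫ (cornerIncl.lanUnit.app F).app v ≫
      (cornerIncl.lan.obj F).map (toTop v.obj) =
      (cornerIncl.lanUnit.app F).app v₀₀ ≫ (cornerIncl.lan.obj F).map (toTop v₀₀.obj) := by
    have h := (cornerIncl.lanUnit.app F).naturality e
    rw [← Category.assoc]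
    refine (h =≫ _).trans ?_
    rw [Category.assoc]
    congr 1
    exact ((cornerIncl.lan.obj F).map_comp _ _).symm
  have ex (s : PushoutCocone (F.map e₁₀) (F.map e₀₁)) :
      ∃ d : (cornerIncl.lan.obj F).obj (1, 1) ⟶ s.pt,
        ((cornerIncl.lanUnit.app F).app v₁₀ ≫ (cornerIncl.lan.obj F).map (toTop v₁₀.obj)) ≫ d =
          s.inl ∧
        ((cornerIncl.lanUnit.app F).app v₀₁ ≫ (cornerIncl.lan.obj F).map (toTop v₀₁.obj)) ≫ d =
          s.inr := by
    let nt : F ⟶ cornerIncl ⋙ (Functor.const _).obj s.pt :=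
      natTransV (F.map e₁₀ ≫ s.inl) s.inl s.inr (Category.comp_id _).symm
        (s.condition.symm.trans (Category.comp_id _).symm)
    let δ := (cornerIncl.lan.obj F).descOfIsLeftKanExtension (cornerIncl.lanUnit.app F) _ nt
    have hδ (v : V) : ((cornerIncl.lanUnit.app F).app v ≫
        (cornerIncl.lan.obj F).map (toTop v.obj)) ≫ δ.app (1, 1) = nt.app v := by
      rw [Category.assoc, δ.naturality]
      refine Eq.trans ?_ ((cornerIncl.lan.obj F).descOfIsLeftKanExtension_fac_app
        (cornerIncl.lanUnit.app F) _ nt v)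
      exact congrArg _ (Category.comp_id _)
    exact ⟨δ.app (1, 1), hδ v₁₀, hδ v₀₁⟩
  choose d hd hd' using ex
  refine ⟨⟨(w e₁₀).trans (w e₀₁).symm⟩, ⟨PushoutCocone.IsColimit.mk _ d hd hd' ?_⟩⟩
  intro s m hm hm'
  have h₁ := hm.trans (hd s).symm
  have h₂ := hm'.trans (hd' s).symm
  refine lan_hom_ext F (forall_V ?_ ?_ ?_)
  · simpa only [Category.assoc] using (w e₁₀ =≫ m).symm.trans
      ((by simpa only [Category.assoc] using F.map e₁₀ ≫= h₁ : _ = (_ ≫ _ ≫ _) ≫ d s).trans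
        (w e₁₀ =≫ d s))
  · simpa only [Category.assoc] using h₂
  · simpa only [Category.assoc] using h₁

/-- Weak equivalences of cofibrant spans induce weak equivalences on left Kan extensions. -/
lemma weakEquivalence_lan {M : Type u} [Category.{v} M] [ModelCategory M] {F G : V ⥤ M} (φ : F ⟶ G)
    (hF : cofibrantSpans M F) (hG : cofibrantSpans M G) (hφ : diagW M V φ) :
    diagW M (I × I) (cornerIncl.lan.map φ) := by
  have hn (v : V) : φ.app v ≫ (cornerIncl.lanUnit.app G).app v =
      (cornerIncl.lanUnit.app F).app v ≫ (cornerIncl.lan.map φ).app v.obj :=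
    NatTrans.congr_app (cornerIncl.lanUnit.naturality φ) v
  -- The inclusion of `V` is fully faithful, so the unit is invertible and only the vertex `(1, 1)`
  -- needs the gluing lemma.
  have hV (v : V) : WeakEquivalence ((cornerIncl.lan.map φ).app v.obj) := by
    have : WeakEquivalence (φ.app v) := ⟨hφ v⟩
    exact weakEquivalence_of_precomp_of_fac (hn v).symm
  have hT (v : V) : ((cornerIncl.lanUnit.app F).app v ≫
      (cornerIncl.lan.obj F).map (toTop v.obj)) ≫ (cornerIncl.lan.map φ).app (1, 1) =
      φ.app v ≫ (cornerIncl.lanUnit.app G).app v ≫ (cornerIncl.lan.obj G).map (toTop v.obj) := by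
    rw [Category.assoc, NatTrans.naturality, reassoc_of% hn v]
    rfl
  have := hF.1 v₀₀
  have := hF.1 v₁₀
  have := hG.1 v₀₀
  have := hG.1 v₁₀
  have := hF.2
  have := hG.2
  have : WeakEquivalence (φ.app v₀₀) := ⟨hφ _⟩
  have : WeakEquivalence (φ.app v₀₁) := ⟨hφ _⟩
  have : WeakEquivalence (φ.app v₁₀) := ⟨hφ _⟩
  have h₁₁ : WeakEquivalence ((cornerIncl.lan.map φ).app (1, 1)) :=
    weakEquivalence_of_span (isPushout_lan F) (isPushout_lan G) (φ.naturality _) (φ.naturality _)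
      (hT v₁₀) (hT v₀₁)
  rintro ⟨i, j⟩
  rw [← weakEquivalence_iff]
  by_cases h : (i, j) = (1, 1)
  · rw [h]; exact h₁₁
  · exact hV ⟨(i, j), h⟩

end Corner

/-! ### Homotopical properties of the tensor product. -/

section Tensor

/-- Ken Brown's lemma for functors preserving trivial cofibrations between cofibrant objects. -/
lemma weakEquivalence_map_of_isCofibrant {M : Type*} [Category* M] [ModelCategory M]
    {N : Type*} [Category* N] [ModelCategory N]
    (F : M ⥤ N)
    (hF : ∀ ⦃X Y : M⦄ (f : X ⟶ Y) [Cofibration f] [WeakEquivalence f], WeakEquivalence (F.map f))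
    {X Y : M} (f : X ⟶ Y) [IsCofibrant X] [IsCofibrant Y] [WeakEquivalence f] :
    WeakEquivalence (F.map f) := by
  let h : CofibrantBrownFactorization f := Classical.arbitrary _
  have := hF h.i
  have := hF h.s
  have hs : F.map h.s ≫ F.map h.p = 𝟙 _ := by rw [← F.map_comp, h.s_p, F.map_id]
  have : WeakEquivalence (F.map h.p) := weakEquivalence_of_precomp_of_fac hs
  rw [← h.fac, F.map_comp]
  infer_instance

variable {M : Type u} [Category.{v} M] [ModelCategory M] [MonoidalCategory M]
  [MonoidalModelCategory M]

instance (X : M) : (tensorLeft X).IsLeftAdjoint :=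
  MonoidalModelCategory.tensorLeft_isLeftAdjoint X

instance (X : M) : (tensorRight X).IsLeftAdjoint :=
  MonoidalModelCategory.tensorRight_isLeftAdjoint X

/-- Tensoring with the initial object on the right gives an initial object. -/
def isInitialTensorRight (X : M) : IsInitial (X ⊗ ⊥_ M) :=
  IsInitial.isInitialObj (tensorLeft X) _ initialIsInitial

/-- Tensoring with the initial object on the left gives an initial object. -/
def isInitialTensorLeft (X : M) : IsInitial ((⊥_ M) ⊗ X) :=
  IsInitial.isInitialObj (tensorRight X) _ initialIsInitial

/-- Tensoring preserves the initial object, so the pushout product of `f` with `⊥_ M ⟶ W` is `f ▷ W`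
up to an isomorphism of sources. This lets the pushout-product axiom speak about whiskering. -/
lemma exists_fac_whiskerRight {X Y : M} (f : X ⟶ Y) (W : M) :
    ∃ (Z : M) (j : X ⊗ W ⟶ Z) (k : Z ⟶ Y ⊗ W), IsIso j ∧ j ≫ k = f ▷ W ∧
      (Cofibration ((MonoidalCategory.Arrow.pushoutProduct.obj (Arrow.mk f)).obj
        (Arrow.mk (initial.to W))).hom → Cofibration k) ∧
      (WeakEquivalence ((MonoidalCategory.Arrow.pushoutProduct.obj (Arrow.mk f)).obj
        (Arrow.mk (initial.to W))).hom → WeakEquivalence k) := by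
  have : IsIso (f ▷ (⊥_ M)) :=
    isIso_of_isInitial (isInitialTensorRight _) (isInitialTensorRight _) _
  have : IsIso (pushout.inr (f ▷ (⊥_ M)) (X ◁ initial.to W)) := inferInstance
  exact ⟨_, pushout.inr (f ▷ (⊥_ M)) (X ◁ initial.to W), _, this, pushout.inr_desc _ _ _, id, id⟩

lemma exists_fac_whiskerLeft {X Y : M} (f : X ⟶ Y) (W : M) :
    ∃ (Z : M) (j : W ⊗ X ⟶ Z) (k : Z ⟶ W ⊗ Y), IsIso j ∧ j ≫ k = W ◁ f ∧
      (Cofibration ((MonoidalCategory.Arrow.pushoutProduct.obj (Arrow.mk (initial.to W))).obj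
        (Arrow.mk f)).hom → Cofibration k) ∧
      (WeakEquivalence ((MonoidalCategory.Arrow.pushoutProduct.obj (Arrow.mk (initial.to W))).obj
        (Arrow.mk f)).hom → WeakEquivalence k) := by
  have : IsIso ((⊥_ M) ◁ f) :=
    isIso_of_isInitial (isInitialTensorLeft _) (isInitialTensorLeft _) _
  have : IsIso (pushout.inl (initial.to W ▷ X) ((⊥_ M) ◁ f)) := inferInstance
  exact ⟨_, pushout.inl (initial.to W ▷ X) ((⊥_ M) ◁ f), _, this, pushout.inl_desc _ _ _, id, id⟩

instance cofibration_whiskerRight {X Y : M} (f : X ⟶ Y) [Cofibration f] (W : M) [IsCofibrant W] :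
    Cofibration (f ▷ W) := by
  obtain ⟨Z, j, k, _, e, h, -⟩ := exists_fac_whiskerRight f W
  have := h (MonoidalModelCategory.cofibration_pushoutProduct (Arrow.mk f) (Arrow.mk (initial.to W))
    ‹_› ‹_›)
  rw [← e]
  infer_instance

lemma weakEquivalence_whiskerRight_of_cofibration {X Y : M} (f : X ⟶ Y) [Cofibration f]
    [WeakEquivalence f] (W : M) [IsCofibrant W] : WeakEquivalence (f ▷ W) := by
  obtain ⟨Z, j, k, _, e, -, h⟩ := exists_fac_whiskerRight f W
  have := h (MonoidalModelCategory.weakEquivalence_pushoutProduct (Arrow.mk f)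
    (Arrow.mk (initial.to W)) ‹_› ‹_› (.inl ‹_›))
  rw [← e]
  infer_instance

instance cofibration_whiskerLeft {X Y : M} (f : X ⟶ Y) [Cofibration f] (W : M) [IsCofibrant W] :
    Cofibration (W ◁ f) := by
  obtain ⟨Z, j, k, _, e, h, -⟩ := exists_fac_whiskerLeft f W
  have := h (MonoidalModelCategory.cofibration_pushoutProduct (Arrow.mk (initial.to W)) (Arrow.mk f)
    ‹_› ‹_›)
  rw [← e]
  infer_instance

lemma weakEquivalence_whiskerLeft_of_cofibration {X Y : M} (f : X ⟶ Y) [Cofibration f]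
    [WeakEquivalence f] (W : M) [IsCofibrant W] : WeakEquivalence (W ◁ f) := by
  obtain ⟨Z, j, k, _, e, -, h⟩ := exists_fac_whiskerLeft f W
  have := h (MonoidalModelCategory.weakEquivalence_pushoutProduct
    (Arrow.mk (initial.to W)) (Arrow.mk f) ‹_› ‹_› (.inr ‹_›))
  rw [← e]
  infer_instance

instance isCofibrant_tensor (X W : M) [IsCofibrant X] [IsCofibrant W] : IsCofibrant (X ⊗ W) :=
  (isCofibrant_iff_of_isInitial (initial.to X ▷ W) (isInitialTensorLeft W)).2 inferInstance

lemma weakEquivalence_whiskerRight {X Y : M} (f : X ⟶ Y) [IsCofibrant X] [IsCofibrant Y]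
    [WeakEquivalence f] (W : M) [IsCofibrant W] : WeakEquivalence (f ▷ W) :=
  weakEquivalence_map_of_isCofibrant (tensorRight W)
    (fun _ _ f _ _ => weakEquivalence_whiskerRight_of_cofibration f W) f

lemma weakEquivalence_whiskerLeft {X Y : M} (f : X ⟶ Y) [IsCofibrant X] [IsCofibrant Y]
    [WeakEquivalence f] (W : M) [IsCofibrant W] : WeakEquivalence (W ◁ f) :=
  weakEquivalence_map_of_isCofibrant (tensorLeft W)
    (fun _ _ f _ _ => weakEquivalence_whiskerLeft_of_cofibration f W) f

lemma weakEquivalence_tensorHom {X X' Y Y' : M} (f : X ⟶ X') (g : Y ⟶ Y') [IsCofibrant X]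
    [IsCofibrant X'] [IsCofibrant Y] [IsCofibrant Y'] [WeakEquivalence f] [WeakEquivalence g] :
    WeakEquivalence (f ⊗ₘ g) := by
  have := weakEquivalence_whiskerRight f Y
  have := weakEquivalence_whiskerLeft g X'
  rw [MonoidalCategory.tensorHom_def]
  infer_instance

end Tensor

/-! ### The pushout smash product on cofibrant arrows. -/

section Box

section

variable {M : Type u} [Category.{v} M] [ModelCategory M] [MonoidalCategory M]
variable (F G : I ⥤ M)

/-- The first inclusion in the source of the pushout smash product. -/
def boxInl : F.obj 1 ⊗ G.obj 0 ⟶ ((box M).obj (F, G)).obj 0 :=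
  pushout.inl (F.map edgeI ▷ G.obj 0) (F.obj 0 ◁ G.map edgeI)

/-- The second inclusion in the source of the pushout smash product. -/
def boxInr : F.obj 0 ⊗ G.obj 1 ⟶ ((box M).obj (F, G)).obj 0 :=
  pushout.inr (F.map edgeI ▷ G.obj 0) (F.obj 0 ◁ G.map edgeI)

lemma isPushout_box :
    IsPushout (F.map edgeI ▷ G.obj 0) (F.obj 0 ◁ G.map edgeI) (boxInl F G) (boxInr F G) :=
  IsPushout.of_hasPushout _ _

lemma boxInl_map : boxInl F G ≫ ((box M).obj (F, G)).map edgeI = F.obj 1 ◁ G.map edgeI :=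
  pushout.inl_desc _ _ _

lemma boxInr_map : boxInr F G ≫ ((box M).obj (F, G)).map edgeI = F.map edgeI ▷ G.obj 1 :=
  pushout.inr_desc _ _ _

variable {F G} {F' G' : I ⥤ M} (φ : (F, G) ⟶ (F', G'))

lemma boxInl_naturality : boxInl F G ≫ ((box M).map φ).app 0 =
    (φ.1.app 1 ⊗ₘ φ.2.app 0) ≫ boxInl F' G' := by
  rw [MonoidalCategory.tensorHom_def, Category.assoc]
  refine ((isPushout_box F G).inl_desc_assoc (φ.1.app 1 ▷ G.obj 0 ≫ boxInl F' G)
    (φ.1.app 0 ▷ G.obj 1 ≫ boxInr F' G) ?_ _).trans ?_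
  exact (Category.assoc _ _ _).trans (_ ≫= (isPushout_box F' G).inl_desc _ _ _)

lemma boxInr_naturality : boxInr F G ≫ ((box M).map φ).app 0 =
    (φ.1.app 0 ⊗ₘ φ.2.app 1) ≫ boxInr F' G' := by
  rw [MonoidalCategory.tensorHom_def, Category.assoc]
  refine ((isPushout_box F G).inr_desc_assoc (φ.1.app 1 ▷ G.obj 0 ≫ boxInl F' G)
    (φ.1.app 0 ▷ G.obj 1 ≫ boxInr F' G) ?_ _).trans ?_
  exact (Category.assoc _ _ _).trans (_ ≫= (isPushout_box F' G).inr_desc _ _ _)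

lemma box_map_app_one : ((box M).map φ).app 1 = (φ.1.app 1 ⊗ₘ φ.2.app 1) :=
  (MonoidalCategory.tensorHom_def _ _).symm

end

section

variable {M : Type u} [Category.{v} M] [ModelCategory M] [MonoidalCategory M]
  [MonoidalModelCategory M]

lemma cofibrantArrows_box {F G : I ⥤ M} (hF : cofibrantArrows M F) (hG : cofibrantArrows M G) :
    cofibrantArrows M ((box M).obj (F, G)) := by
  obtain ⟨_, _, _⟩ := hF
  obtain ⟨_, _, _⟩ := hG
  refine ⟨?_, inferInstanceAs (IsCofibrant (F.obj 1 ⊗ G.obj 1)), ?_⟩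
  · have := cofibration_of_isPushout (isPushout_box F G)
    exact isCofibrant_of_cofibration (boxInl F G)
  · exact MonoidalModelCategory.cofibration_pushoutProduct
      ((diagramToArrow M).obj F) ((diagramToArrow M).obj G) ‹_› ‹_›

/-- The target is a tensor product of cofibrant objects. The source is a pushout along the
cofibration `F.obj 0 ◁ G.map edgeI`, so the gluing lemma applies. -/
lemma weakEquivalence_box {F G F' G' : I ⥤ M} (φ : (F, G) ⟶ (F', G'))
    (hF : cofibrantArrows M F) (hG : cofibrantArrows M G)
    (hF' : cofibrantArrows M F') (hG' : cofibrantArrows M G')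
    (h₁ : diagW M I φ.1) (h₂ : diagW M I φ.2) : diagW M I ((box M).map φ) := by
  obtain ⟨_, _, _⟩ := hF
  obtain ⟨_, _, _⟩ := hG
  obtain ⟨_, _, _⟩ := hF'
  obtain ⟨_, _, _⟩ := hG'
  have a (i : I) : WeakEquivalence (φ.1.app i) := ⟨h₁ i⟩
  have b (i : I) : WeakEquivalence (φ.2.app i) := ⟨h₂ i⟩
  have := weakEquivalence_tensorHom (φ.1.app 0) (φ.2.app 0)
  have := weakEquivalence_tensorHom (φ.1.app 1) (φ.2.app 0)
  have := weakEquivalence_tensorHom (φ.1.app 0) (φ.2.app 1)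
  have := weakEquivalence_tensorHom (φ.1.app 1) (φ.2.app 1)
  intro i
  rw [← weakEquivalence_iff]
  fin_cases i
  · refine weakEquivalence_of_span (isPushout_box F G) (isPushout_box F' G')
      (α := φ.1.app 0 ⊗ₘ φ.2.app 0) ?_ ?_ (boxInl_naturality φ) (boxInr_naturality φ)
    · rw [← tensorHom_id, ← tensorHom_id, tensorHom_comp_tensorHom, tensorHom_comp_tensorHom,
        φ.1.naturality, Category.id_comp, Category.comp_id]
    · rw [← id_tensorHom, ← id_tensorHom, tensorHom_comp_tensorHom, tensorHom_comp_tensorHom,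
        φ.2.naturality, Category.id_comp, Category.comp_id]
  · exact (box_map_app_one φ).symm ▸ this

end

end Box

/-! ### Cokernels and left adjoints. -/

section Cokernel

variable {M : Type*} [Category* M] [HasZeroMorphisms M]

/-- The morphism `π` is a cokernel of `f`. -/
structure IsCoker {X Y Z : M} (f : X ⟶ Y) (π : Y ⟶ Z) : Prop where
  zero : f ≫ π = 0
  epi : Epi π
  exists_desc {T : M} (h : Y ⟶ T) (hh : f ≫ h = 0) : ∃ k : Z ⟶ T, π ≫ k = h

lemma IsCoker.of_isPushout {X Y Z O : M} {f : X ⟶ Y} {π : Y ⟶ Z} {a : X ⟶ O} {b : O ⟶ Z}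
    (sq : IsPushout a f b π) (hO : IsZero O) : IsCoker f π where
  zero := by rw [← sq.w, hO.eq_zero_of_src b, comp_zero]
  epi := ⟨fun _ _ h => sq.hom_ext (hO.eq_of_src _ _) h⟩
  exists_desc h hh := ⟨sq.desc 0 h (by rw [hh, comp_zero]), sq.inr_desc _ _ _⟩

lemma IsCoker.exists_iso {X Y Z Z' : M} {f : X ⟶ Y} {π : Y ⟶ Z} {π' : Y ⟶ Z'}
    (h : IsCoker f π) (h' : IsCoker f π') : ∃ e : Z ≅ Z', π ≫ e.hom = π' := by
  obtain ⟨k, hk⟩ := h.exists_desc π' h'.zero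
  obtain ⟨k', hk'⟩ := h'.exists_desc π h.zero
  have := h.epi
  have := h'.epi
  exact ⟨⟨k, k', by rw [← cancel_epi π, reassoc_of% hk, hk', Category.comp_id],
    by rw [← cancel_epi π', reassoc_of% hk', hk, Category.comp_id]⟩, hk⟩

lemma IsCoker.map {N : Type*} [Category* N] [HasZeroMorphisms N] [HasZeroObject M] [HasZeroObject N]
    (F : M ⥤ N) [F.IsLeftAdjoint]
    {X Y Z : M} {f : X ⟶ Y} {π : Y ⟶ Z} (h : IsCoker f π) : IsCoker (F.map f) (F.map π) where
  zero := by rw [← F.map_comp, h.zero, F.map_zero]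
  epi := have := h.epi; inferInstance
  exists_desc {T} t ht := by
    let adj := Adjunction.ofIsLeftAdjoint F
    obtain ⟨k, hk⟩ := h.exists_desc (adj.homEquiv _ _ t) (by
      rw [← adj.homEquiv_naturality_left, ht, adj.homEquiv_unit, Functor.map_zero, comp_zero])
    exact ⟨(adj.homEquiv _ _).symm k, by
      rw [← adj.homEquiv_naturality_left_symm, hk, Equiv.symm_apply_apply]⟩

/-- Functors to arrows that are naturally cokernels of the same arrows are isomorphic. -/
lemma nonempty_iso_of_isCoker {K : Type*} [Category* K] (T E E' : K ⥤ I ⥤ M)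
    (a : T ⋙ (evaluation I M).obj 1 ≅ E ⋙ (evaluation I M).obj 0)
    (a' : T ⋙ (evaluation I M).obj 1 ≅ E' ⋙ (evaluation I M).obj 0)
    (h : ∀ k, IsCoker ((T.obj k).map edgeI) (a.hom.app k ≫ (E.obj k).map edgeI))
    (h' : ∀ k, IsCoker ((T.obj k).map edgeI) (a'.hom.app k ≫ (E'.obj k).map edgeI)) :
    Nonempty (E ≅ E') := by
  -- The isomorphisms are chosen object by object; naturality is automatic because cokernel maps are
  -- epimorphisms.
  choose e he using fun k => (h k).exists_iso (h' k)
  have := fun k => (h k).epi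
  refine ⟨NatIso.ofComponents (fun k => ComposableArrows.isoMk₁
    (a.symm.app k ≪≫ a'.app k) (e k) ?_) ?_⟩
  · rw [← cancel_epi (a.hom.app k)]
    exact (Category.assoc _ _ _).symm.trans ((he k).trans (by simp))
  · intro k k' f
    refine ComposableArrows.hom_ext₁ ?_ ?_
    · have h₁ := a.inv.naturality f
      have h₂ := a'.hom.naturality f
      dsimp at h₁ h₂ ⊢
      change (E.map f).app 0 ≫ a.inv.app k' ≫ a'.hom.app k' =
        (a.inv.app k ≫ a'.hom.app k) ≫ (E'.map f).app 0
      rw [reassoc_of% h₁, h₂, Category.assoc]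
    · have h₁ := a.hom.naturality f
      have h₂ := a'.hom.naturality f
      dsimp at h₁ h₂ ⊢
      change (E.map f).app 1 ≫ (e k').hom = (e k).hom ≫ (E'.map f).app 1
      rw [← cancel_epi (a.hom.app k ≫ (E.obj k).map edgeI), Category.assoc, Category.assoc,
        reassoc_of% he k, NatTrans.naturality, NatTrans.naturality_assoc, ← reassoc_of% h₁,
        ← reassoc_of% h₂, ← he k', Category.assoc]

end Cokernel

/-! ### The strict cone and the strict comparison. -/

section StrictCone

variable (M : Type u) [Category.{v} M] [ModelCategory M] [HasZeroObject M] [HasZeroMorphisms M]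

/-- The strict cone inclusion functor. -/
def strictCone : (I ⥤ M) ⥤ (I ⥤ M) :=
  starDiagram M ⋙ cornerIncl.lan ⋙ (edgeLocalizerMorphism M).functor

/-- The source of the strict cone inclusion of `f : X ⟶ Y` is `Y`. -/
def strictConeSource : 𝟭 (I ⥤ M) ⋙ (evaluation I M).obj 1 ≅
    strictCone M ⋙ (evaluation I M).obj 0 :=
  Functor.isoWhiskerLeft (starDiagram M) (Functor.isoWhiskerRight
    (asIso (cornerIncl.lanUnit (H := M))) ((evaluation V M).obj v₀₁))

lemma isPushout_strictCone (F : I ⥤ M) : IsPushout (0 : F.obj 0 ⟶ (0 : M)) (F.map edgeI)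
    ((cornerIncl.lanUnit.app ((starDiagram M).obj F)).app v₁₀ ≫
      (cornerIncl.lan.obj ((starDiagram M).obj F)).map (toTop v₁₀.obj))
    ((strictConeSource M).hom.app F ≫ ((strictCone M).obj F).map edgeI) := by
  have h := isPushout_lan ((starDiagram M).obj F)
  have h₁ : ((starDiagram M).obj F).map e₁₀ = (0 : F.obj 0 ⟶ (0 : M)) :=
    Category.comp_id (0 : F.obj 0 ⟶ (0 : M))
  have h₂ : ((starDiagram M).obj F).map e₀₁ = F.map edgeI := Category.id_comp (F.map edgeI)
  rw [h₁, h₂] at h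
  exact h

lemma isCoker_strictCone (F : I ⥤ M) : IsCoker (F.map edgeI)
    ((strictConeSource M).hom.app F ≫ ((strictCone M).obj F).map edgeI) :=
  .of_isPushout (isPushout_strictCone M F) (isZero_zero M)

variable [MonoidalCategory M] [MonoidalModelCategory M]

variable {M} in
/-- The tensor product of cokernels is a cokernel of the pushout product. -/
lemma isCoker_tensorHom {X Y Z U W V P : M} {f : X ⟶ Y} {π : Y ⟶ Z} {g : U ⟶ W} {π' : W ⟶ V}
    (h : IsCoker f π) (h' : IsCoker g π') {a : Y ⊗ U ⟶ P} {b : X ⊗ W ⟶ P}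
    (sq : IsPushout (f ▷ U) (X ◁ g) a b) {p : P ⟶ Y ⊗ W} (ha : a ≫ p = Y ◁ g)
    (hb : b ≫ p = f ▷ W) : IsCoker p (π ⊗ₘ π') := by
  have hr (X : M) := h.map (tensorRight X)
  have hl (X : M) := h'.map (tensorLeft X)
  dsimp at hr hl
  have e₀ := (hr U).epi
  have e₁ := (hr W).epi
  have e₂ := (hl Z).epi
  refine ⟨?_, ?_, ?_⟩
  · apply sq.hom_ext
    · rw [reassoc_of% ha, MonoidalCategory.tensorHom_def', comp_zero, ← Category.assoc,
        (hl _).zero, zero_comp]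
    · rw [reassoc_of% hb, MonoidalCategory.tensorHom_def, comp_zero, ← Category.assoc,
        (hr _).zero, zero_comp]
  · rw [MonoidalCategory.tensorHom_def]
    infer_instance
  -- `t` vanishes on `X ⊗ W`, so it factors through `Z ⊗ W`. The factor `k` vanishes on `Z ⊗ U`, as
  -- is seen after composing with the epimorphism `π ▷ U`, so it factors on through `Z ⊗ V`.
  · intro T t ht
    obtain ⟨k, hk⟩ := (hr _).exists_desc t (by rw [← hb, Category.assoc, ht, comp_zero])
    obtain ⟨l, hl⟩ := (hl Z).exists_desc k (by
      rw [← cancel_epi (π ▷ U), ← whisker_exchange_assoc, hk, ← ha, Category.assoc, ht,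
        comp_zero, comp_zero])
    exact ⟨l, by rw [MonoidalCategory.tensorHom_def, Category.assoc, hl, hk]⟩

/-- The strict version of the comparison of cones with pushout products. -/
lemma nonempty_box_strictCone_iso : Nonempty
    (box M ⋙ strictCone M ≅ (strictCone M).prod (strictCone M) ⋙ smash M) := by
  let e := strictConeSource M
  let a' : box M ⋙ (evaluation I M).obj 1 ≅
      ((strictCone M).prod (strictCone M) ⋙ smash M) ⋙ (evaluation I M).obj 0 :=
    NatIso.ofComponents (fun X => MonoidalCategory.tensorIso (e.app X.1) (e.app X.2))
      (fun {X Y} φ => by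
        have h₁ := e.hom.naturality φ.1
        have h₂ := e.hom.naturality φ.2
        refine (box_map_app_one φ =≫ _).trans ?_
        refine (MonoidalCategory.tensorHom_comp_tensorHom _ _ _ _).trans ?_
        refine Eq.trans ?_ (MonoidalCategory.tensorHom_comp_tensorHom _ _ _ _).symm
        exact congrArg₂ (fun a b => a ⊗ₘ b) h₁ h₂)
  refine nonempty_iso_of_isCoker (box M) _ _ (Functor.isoWhiskerLeft (box M) e) a'
    (fun X => isCoker_strictCone M _) (fun X => ?_)
  have h := isCoker_tensorHom (isCoker_strictCone M X.1) (isCoker_strictCone M X.2)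
    (isPushout_box X.1 X.2) (boxInl_map X.1 X.2) (boxInr_map X.1 X.2)
  rw [← MonoidalCategory.tensorHom_comp_tensorHom] at h
  exact h

end StrictCone

/-! ### Comparison of derived and strict functors. -/

section Main

instance functorCategory_hasTwoOutOfThreeProperty {C J : Type*} [Category* C] [Category* J]
    (W : MorphismProperty C) [W.HasTwoOutOfThreeProperty] :
    (W.functorCategory J).HasTwoOutOfThreeProperty where
  comp_mem _ _ hf hg j := W.comp_mem _ _ (hf j) (hg j)
  of_postcomp _ _ hg hfg j := W.of_postcomp _ _ (hg j) (hfg j)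
  of_precomp _ _ hf hfg j := W.of_precomp _ _ (hf j) (hfg j)

instance prod_hasTwoOutOfThreeProperty {C D : Type*} [Category* C] [Category* D]
    (W : MorphismProperty C) (W' : MorphismProperty D) [W.HasTwoOutOfThreeProperty]
    [W'.HasTwoOutOfThreeProperty] : (W.prod W').HasTwoOutOfThreeProperty where
  comp_mem _ _ hf hg := ⟨W.comp_mem _ _ hf.1 hg.1, W'.comp_mem _ _ hf.2 hg.2⟩
  of_postcomp _ _ hg hfg := ⟨W.of_postcomp _ _ hg.1 hfg.1, W'.of_postcomp _ _ hg.2 hfg.2⟩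
  of_precomp _ _ hf hfg := ⟨W.of_precomp _ _ hf.1 hfg.1, W'.of_precomp _ _ hf.2 hfg.2⟩

variable (M : Type u) [Category.{v} M] [ModelCategory M]

lemma isIso_toHo_map {J : Type} [Category.{0} J] {X Y : J ⥤ M} (f : X ⟶ Y) (hf : diagW M J f) :
    IsIso ((toHo M J).map f) :=
  Localization.inverts (toHo M J) (diagW M J) f hf

lemma isIso_cornerLan_map ⦃F G : V ⥤ M⦄ (φ : F ⟶ G) (hF : cofibrantSpans M F)
    (hG : cofibrantSpans M G) (hφ : diagW M V φ) : IsIso ((cornerLan M).map φ) :=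
  isIso_toHo_map M _ (weakEquivalence_lan φ hF hG hφ)

instance : CatCommSq (edgeLocalizerMorphism M).functor (toHo M (I × I)) (toHo M I) (edgeHo M) :=
  inferInstanceAs (CatCommSq (edgeLocalizerMorphism M).functor _ _
    ((edgeLocalizerMorphism M).localizedFunctor _ _))

/-- The arrows between cofibrant objects. -/
def vertexwiseCofibrant : ObjectProperty (I ⥤ M) := fun F => ∀ i, IsCofibrant (F.obj i)

lemma cofibrantArrows_le : cofibrantArrows M ≤ vertexwiseCofibrant M := by
  rintro F ⟨h₀, h₁, -⟩ i
  fin_cases i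
  · exact h₀
  · exact h₁

section

variable [HasZeroObject M] [HasZeroMorphisms M]

instance isCofibrant_zero : IsCofibrant (0 : M) :=
  (isCofibrant_iff_of_isInitial (𝟙 (0 : M)) (isZero_zero M).isInitial).2 inferInstance

variable {M} in
lemma cofibrantSpans_star {F : I ⥤ M} (hF : cofibrantArrows M F) :
    cofibrantSpans M ((starDiagram M).obj F) := by
  refine ⟨forall_V hF.1 hF.2.1 (isCofibrant_zero M), ?_⟩
  have h₂ : ((starDiagram M).obj F).map e₀₁ = F.map edgeI := Category.id_comp (F.map edgeI)
  rw [h₂]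
  exact hF.2.2

variable {M} in
-- The map from `0` to the cone is a pushout of the cofibration `F.map edgeI`. The edge of the cone
-- is a pushout of `X ⟶ 0` and need not be a cofibration, hence the weaker class of arrows.
lemma vertexwiseCofibrant_strictCone {F : I ⥤ M} (hF : cofibrantArrows M F) :
    vertexwiseCofibrant M ((strictCone M).obj F) := by
  obtain ⟨_, _, _⟩ := hF
  have h₁ := cofibration_of_isPushout (isPushout_strictCone M F)
  intro i
  fin_cases i
  · have : IsCofibrant ((𝟭 (I ⥤ M) ⋙ (evaluation I M).obj 1).obj F) := ‹IsCofibrant (F.obj 1)›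
    exact isCofibrant_of_cofibration ((strictConeSource M).hom.app F)
  · exact (isCofibrant_iff_of_isInitial _ (isZero_zero M).isInitial).2 h₁

instance : CatCommSq (starDiagram M) (toHo M I) (toHo M V) (starHo M) :=
  inferInstanceAs (CatCommSq (starLocalizerMorphism M).functor _ _
    ((starLocalizerMorphism M).localizedFunctor _ _))

variable [(cornerLan M).HasLeftDerivedFunctor (diagW M V)]

/-- The comparison from the cone inclusion functor to the strict cone inclusion functor. -/
def coneCounit : toHo M I ⋙ coneInclusion M ⟶ strictCone M ⋙ toHo M I :=
  Functor.whiskerRight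
      (CatCommSq.iso (starDiagram M) (toHo M I) (toHo M V) (starHo M)).inv
      (cornerHoLan M ⋙ edgeHo M) ≫
    Functor.whiskerLeft (starDiagram M) (Functor.whiskerRight
      ((cornerLan M).totalLeftDerivedCounit (toHo M V) (diagW M V)) (edgeHo M)) ≫
    Functor.whiskerLeft (starDiagram M ⋙ cornerIncl.lan)
      (CatCommSq.iso (edgeLocalizerMorphism M).functor (toHo M (I × I)) (toHo M I) (edgeHo M)).inv

/-- Only the Kan extension is genuinely derived: the other two factors of `coneCounit` are
invertible everywhere. -/
lemma isIso_coneCounit_app [(cofibrations M).HasFunctorialFactorization (trivialFibrations M)]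
    (F : I ⥤ M) (hF : cofibrantArrows M F) : IsIso ((coneCounit M).app F) := by
  obtain ⟨d⟩ := exists_leftDeformation_V M
  have h := d.isIso_app_of_isLeftDerivedFunctor (toHo M V) (isIso_cornerLan_map M)
    ((cornerLan M).totalLeftDerivedCounit (toHo M V) (diagW M V)) (cofibrantSpans_star hF)
  have h₁ : IsIso ((cornerHoLan M ⋙ edgeHo M).map
    ((CatCommSq.iso (starDiagram M) (toHo M I) (toHo M V) (starHo M)).inv.app F)) := inferInstance
  have h₂ : IsIso ((edgeHo M).map
    (((cornerLan M).totalLeftDerivedCounit (toHo M V) (diagW M V)).app ((starDiagram M).obj F))) :=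
    inferInstance
  have h₃ : IsIso ((CatCommSq.iso (edgeLocalizerMorphism M).functor (toHo M (I × I)) (toHo M I)
    (edgeHo M)).inv.app (cornerIncl.lan.obj ((starDiagram M).obj F))) := inferInstance
  exact IsIso.comp_isIso' h₁ (IsIso.comp_isIso' h₂ h₃)

end

variable [MonoidalCategory M] [MonoidalModelCategory M]

instance : (cofibrations M).HasFunctorialFactorization (trivialFibrations M) :=
  MonoidalModelCategory.functorialFactorization_trivialFibration

instance : (cornerLan M).HasLeftDerivedFunctor (diagW M V) :=
  (exists_leftDeformation_V M).some.hasLeftDerivedFunctor (isIso_cornerLan_map M)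

lemma isIso_box_map ⦃X Y : (I ⥤ M) × (I ⥤ M)⦄ (φ : X ⟶ Y)
    (hX : cofibrantArrows M X.1 ∧ cofibrantArrows M X.2)
    (hY : cofibrantArrows M Y.1 ∧ cofibrantArrows M Y.2)
    (hφ : ((diagW M I).prod (diagW M I)) φ) : IsIso ((box M ⋙ toHo M I).map φ) :=
  isIso_toHo_map M _ (weakEquivalence_box φ hX.1 hX.2 hY.1 hY.2 hφ.1 hφ.2)

lemma isIso_smash_map ⦃X Y : (I ⥤ M) × (I ⥤ M)⦄ (φ : X ⟶ Y)
    (hX : vertexwiseCofibrant M X.1 ∧ vertexwiseCofibrant M X.2)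
    (hY : vertexwiseCofibrant M Y.1 ∧ vertexwiseCofibrant M Y.2)
    (hφ : ((diagW M I).prod (diagW M I)) φ) : IsIso ((smash M ⋙ toHo M I).map φ) := by
  refine isIso_toHo_map M _ (fun i => ?_)
  have := hX.1 i
  have := hX.2 i
  have := hY.1 i
  have := hY.2 i
  have : WeakEquivalence (φ.1.app i) := ⟨hφ.1 i⟩
  have : WeakEquivalence (φ.2.app i) := ⟨hφ.2 i⟩
  exact (weakEquivalence_tensorHom (φ.1.app i) (φ.2.app i)).mem

/-- Cofibrant resolutions of pairs of arrows. -/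
def arrowDeformation₂ : LeftDeformation ((diagW M I).prod (diagW M I))
    (fun X => cofibrantArrows M X.1 ∧ cofibrantArrows M X.2) :=
  (exists_leftDeformation_I M).some.prod (exists_leftDeformation_I M).some

/-- Vertex-wise cofibrant resolutions of pairs of arrows. -/
def vertexwiseDeformation₂ : LeftDeformation ((diagW M I).prod (diagW M I))
    (fun X => vertexwiseCofibrant M X.1 ∧ vertexwiseCofibrant M X.2) :=
  (arrowDeformation₂ M).ofLE
    (fun _ hX => ⟨cofibrantArrows_le M _ hX.1, cofibrantArrows_le M _ hX.2⟩)

instance : HasDerived₂ M (box M) :=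
  (arrowDeformation₂ M).hasLeftDerivedFunctor (isIso_box_map M)

instance : HasDerived₂ M (smash M) :=
  (vertexwiseDeformation₂ M).hasLeftDerivedFunctor (isIso_smash_map M)

/-- The counit of the total left derived functor of a functor of two variables. -/
abbrev derived₂Counit (F : (I ⥤ M) × (I ⥤ M) ⥤ (I ⥤ M)) [HasDerived₂ M F] :
    (toHo M I).prod (toHo M I) ⋙ derived₂ M F ⟶ F ⋙ toHo M I :=
  (F ⋙ toHo M I).totalLeftDerivedCounit ((toHo M I).prod (toHo M I))
    ((diagW M I).prod (diagW M I))

instance (F : (I ⥤ M) × (I ⥤ M) ⥤ (I ⥤ M)) [HasDerived₂ M F] :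
    (derived₂ M F).IsLeftDerivedFunctor (derived₂Counit M F) ((diagW M I).prod (diagW M I)) :=
  inferInstanceAs (((F ⋙ toHo M I).totalLeftDerived _ _).IsLeftDerivedFunctor
    ((F ⋙ toHo M I).totalLeftDerivedCounit _ _) _)

variable [HasZeroObject M] [HasZeroMorphisms M]

/-- The comparison from the cone of the derived pushout smash product to the strict version. -/
def boxConeCounit : (toHo M I).prod (toHo M I) ⋙ derived₂ M (box M) ⋙ coneInclusion M ⟶
    (box M ⋙ strictCone M) ⋙ toHo M I :=
  Functor.whiskerRight (derived₂Counit M (box M)) (coneInclusion M) ≫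
    Functor.whiskerLeft (box M) (coneCounit M)

/-- The comparison from the derived internal smash product of cones to the strict version. -/
def smashConeCounit : (toHo M I).prod (toHo M I) ⋙
      (coneInclusion M).prod (coneInclusion M) ⋙ derived₂ M (smash M) ⟶
    ((strictCone M).prod (strictCone M) ⋙ smash M) ⋙ toHo M I :=
  Functor.whiskerRight (NatTrans.prod (coneCounit M) (coneCounit M)) (derived₂ M (smash M)) ≫
    Functor.whiskerLeft ((strictCone M).prod (strictCone M)) (derived₂Counit M (smash M))

/-- The derived functors compose because the pushout product of cofibrant arrows is again a
cofibrant arrow. -/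
lemma isIso_boxConeCounit_app (X : (I ⥤ M) × (I ⥤ M))
    (hX : cofibrantArrows M X.1 ∧ cofibrantArrows M X.2) : IsIso ((boxConeCounit M).app X) := by
  have h₁ := (arrowDeformation₂ M).isIso_app_of_isLeftDerivedFunctor _ (isIso_box_map M)
    (derived₂Counit M (box M)) hX
  have h₂ := isIso_coneCounit_app M _ (cofibrantArrows_box hX.1 hX.2)
  dsimp [boxConeCounit]
  exact IsIso.comp_isIso

/-- The smash product is evaluated at strict cones, so its counit is controlled by the vertex-wise
cofibrant resolutions. -/
lemma isIso_smashConeCounit_app (X : (I ⥤ M) × (I ⥤ M))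
    (hX : cofibrantArrows M X.1 ∧ cofibrantArrows M X.2) : IsIso ((smashConeCounit M).app X) := by
  have h₁ := (vertexwiseDeformation₂ M).isIso_app_of_isLeftDerivedFunctor _ (isIso_smash_map M)
    (derived₂Counit M (smash M)) (X := ((strictCone M).prod (strictCone M)).obj X)
    ⟨vertexwiseCofibrant_strictCone hX.1, vertexwiseCofibrant_strictCone hX.2⟩
  have h₂ := isIso_coneCounit_app M _ hX.1
  have h₃ := isIso_coneCounit_app M _ hX.2
  have h₄ : IsIso ((NatTrans.prod (coneCounit M) (coneCounit M)).app X) :=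
    (isIso_prod_iff _ _).2 ⟨h₂, h₃⟩
  have h₅ : IsIso ((derived₂ M (smash M)).map
      ((NatTrans.prod (coneCounit M) (coneCounit M)).app X)) :=
    inferInstance
  exact IsIso.comp_isIso' h₅ h₁

end Main

end DiagramCone

end

theorem mainTheorem5 (M : Type u) [Category.{v} M] [ModelCategory M] [HasZeroObject M]
    [HasZeroMorphisms M] [MonoidalCategory M] [DiagramCone.MonoidalModelCategory M] :
    ∃ (_ : (DiagramCone.cornerLan M).HasLeftDerivedFunctor
          (DiagramCone.diagW M DiagramCone.V))
      (_ : DiagramCone.HasDerived₂ M (DiagramCone.box M))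
      (_ : DiagramCone.HasDerived₂ M (DiagramCone.smash M)),
      Nonempty
        (DiagramCone.derived₂ M (DiagramCone.box M) ⋙ DiagramCone.coneInclusion M ≅
          (DiagramCone.coneInclusion M).prod (DiagramCone.coneInclusion M) ⋙
            DiagramCone.derived₂ M (DiagramCone.smash M)) := by
  obtain ⟨e⟩ := DiagramCone.nonempty_box_strictCone_iso M
  refine ⟨inferInstance, inferInstance, inferInstance,
    (DiagramCone.arrowDeformation₂ M).nonempty_iso
      ((DiagramCone.toHo M DiagramCone.I).prod (DiagramCone.toHo M DiagramCone.I))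
      (DiagramCone.boxConeCounit M ≫ Functor.whiskerRight e.hom _)
      (DiagramCone.smashConeCounit M) (fun X hX => ?_)
      (DiagramCone.isIso_smashConeCounit_app M)⟩
  have := DiagramCone.isIso_boxConeCounit_app M X hX
  dsimp
  infer_instance
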